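/- Let $\Omega$ be a compact metric space with its Borel $\sigma$-algebra, let $T\colon\Omega\to\Omega$ be a measurable invertible map, let $\nu$ be a $T$-invariant ergodic Borel probability measure on $\Omega$, and let $\psi\in L^2(\Omega,\nu)$ be complex valued. Let $\mathbf T=\mathbf R/\mathbf Z$ with Lebesgue measure $d\lambda$ of total mass one, and for $\omega\in\Omega$, $n\ge 1$, $\lambda\in\mathbf T$ put $$S_n^\omega(\lambda):=\sum_{k=0}^{n-1}e^{2\pi i\lambda k}\,\psi(T^k\omega).$$ Let $U\phi:=\phi\circ T$ be the associated unitary operator on $L^2(\Omega,\nu)$, and let $\mu_\psi$ be the spectral measure of $\psi$, i.e. the unique finite positive Borel measure on $\mathbf T$ with $\int_{\mathbf T}e^{-2\pi i n x}\,d\mu_\psi(x)=(U^n\psi,\psi)=\int_\Omega (U^n\psi)\,\overline{\psi}\,d\nu$ for all $n\in\mathbf Z$. Then for $\nu$-a.e. $\omega\in\Omega$ the measures $n^{-1}|S_n^\omega(\lambda)|^2\,d\lambda$ converge weakly to $\mu_\psi$ as $n\to\infty$. If moreover $(\Omega,T,\nu)$ is uniquely ergodic, i.e. $T$ is continuous and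 $\nu$ is the only $T$-invariant Borel probability measure on $\Omega$, and $\psi$ is continuous, then the convergence holds for every $\omega\in\Omega$. -/

import Mathlib

open MeasureTheory Filter Topology
open scoped ENNReal InnerProductSpace

noncomputable section

namespace TwistedWalk

/-! ### Spectral measures of unitary operators -/

section SpectralMeasure

variable {H : Type*} [NormedAddCommGroup H] [InnerProductSpace ℂ H]

/-- `μ` is the spectral measure of `ψ` for the unitary operator `U`: a finite positive Borel
measure on the circle `ℝ/ℤ` with `∫ e^{-2πinx} dμ(x) = (U^n ψ, ψ)` for every integer `n`.
The inner product `(·,·)` is linear in its first argument; Mathlib's `⟪x, y⟫_ℂ` is linear in `y`,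
so that `(U^n ψ, ψ)` is `⟪ψ, U^n ψ⟫_ℂ`. -/
def IsSpectralMeasure (U : H ≃ₗᵢ[ℂ] H) (ψ : H) (μ : FiniteMeasure UnitAddCircle) : Prop :=
  ∀ n : ℤ, ∫ x, fourier (-n) x ∂(μ : Measure UnitAddCircle) = ⟪ψ, (U ^ n) ψ⟫_ℂ

/-- Integration against a finite measure on the circle, as a functional on `C(ℝ/ℤ, ℂ)`. -/
def integralFunctional (μ : FiniteMeasure UnitAddCircle) : C(UnitAddCircle, ℂ) →L[ℂ] ℂ :=
  LinearMap.mkContinuous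
    { toFun := fun f => ∫ x, f x ∂(μ : Measure UnitAddCircle)
      map_add' := fun f g => integral_add
        (f.continuous.integrable_of_hasCompactSupport (HasCompactSupport.of_compactSpace _))
        (g.continuous.integrable_of_hasCompactSupport (HasCompactSupport.of_compactSpace _))
      map_smul' := fun c f => integral_const_mul c _ }
    ((μ : Measure UnitAddCircle).real Set.univ)
    (fun f => by
      rw [mul_comm]
      exact norm_integral_le_of_norm_le_const (Eventually.of_forall fun x => f.norm_coe_le_norm x))

theorem IsSpectralMeasure.unique {U : H ≃ₗᵢ[ℂ] H} {ψ : H} {μ μ' : FiniteMeasure UnitAddCircle}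
    (h : IsSpectralMeasure U ψ μ) (h' : IsSpectralMeasure U ψ μ') : μ = μ' := by
  have key : integralFunctional μ = integralFunctional μ' := by
    apply ContinuousLinearMap.ext_on (s := Set.range (@fourier 1))
    · exact (Submodule.dense_iff_topologicalClosure_eq_top).2 span_fourier_closure_eq_top
    · rintro _ ⟨n, rfl⟩
      have h1 := h (-n)
      rw [← h' (-n), neg_neg] at h1
      exact h1
  apply Subtype.ext
  change (μ : Measure UnitAddCircle) = (μ' : Measure UnitAddCircle)
  apply ext_of_forall_integral_eq_of_IsFiniteMeasure
  intro f
  have := congrArg (fun L => L ⟨fun x => (f x : ℂ), by fun_prop⟩) key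
  change ∫ x, (f x : ℂ) ∂(μ : Measure UnitAddCircle) = ∫ x, (f x : ℂ) ∂(μ' : Measure UnitAddCircle)
    at this
  rw [integral_complex_ofReal, integral_complex_ofReal] at this
  exact_mod_cast this

variable [CompleteSpace H]

open scoped ComplexOrder in
theorem exists_isSpectralMeasure (U : H ≃ₗᵢ[ℂ] H) (ψ : H) :
    ∃ μ : FiniteMeasure UnitAddCircle, IsSpectralMeasure U ψ μ := by
  set u : unitary (H →L[ℂ] H) := Unitary.linearIsometryEquiv.symm U with hu
  have hun : IsStarNormal (u : H →L[ℂ] H) := inferInstance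
  have hcirc : ∀ z : spectrum ℂ (u : H →L[ℂ] H), (z : ℂ) ∈ Metric.sphere (0 : ℂ) 1 := fun z =>
    Unitary.spectrum_subset_circle u z.2
  -- the point of the spectrum `e^{-2πix}` corresponds to the point `x` of the circle
  let c : C(spectrum ℂ (u : H →L[ℂ] H), Circle) :=
    ⟨fun z => (⟨z, hcirc z⟩ : Circle), by
      exact Continuous.subtype_mk continuous_subtype_val _⟩
  let g : C(spectrum ℂ (u : H →L[ℂ] H), UnitAddCircle) :=
    ⟨fun z => (AddCircle.homeomorphCircle one_ne_zero).symm (c z)⁻¹, by fun_prop⟩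
  have hg : ∀ (n : ℤ) z, fourier (-n) (g z) = ((c z ^ n : Circle) : ℂ) := by
    intro n z
    have h1 : AddCircle.toCircle (g z) = (c z)⁻¹ := by
      rw [← AddCircle.homeomorphCircle_apply one_ne_zero]
      exact Homeomorph.apply_symm_apply _ _
    rw [fourier_apply, AddCircle.toCircle_zsmul, h1]
    simp
  let Φ := cfcHom (R := ℂ) hun
  let A : C(UnitAddCircle, ℂ) →ₗ[ℂ] ℂ :=
    { toFun := fun f => ⟪ψ, Φ (f.comp g) ψ⟫_ℂ
      map_add' := fun f f' => by
        rw [ContinuousMap.add_comp, map_add, add_apply, inner_add_right]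
      map_smul' := fun a f => by
        rw [ContinuousMap.smul_comp, map_smul, smul_apply, inner_smul_right]; rfl }
  let R : C(UnitAddCircle, ℝ) → C(UnitAddCircle, ℂ) := fun f => ⟨fun x => (f x : ℂ), by fun_prop⟩
  have hpos : ∀ f : C(UnitAddCircle, ℝ), 0 ≤ f → 0 ≤ A (R f) := by
    intro f hf
    have h1 : (0 : C(spectrum ℂ (u : H →L[ℂ] H), ℂ)) ≤ (R f).comp g := by
      intro z
      simpa [R] using hf (g z)
    have h2 : 0 ≤ Φ ((R f).comp g) := (cfcHom_nonneg_iff hun).2 h1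
    exact ((ContinuousLinearMap.nonneg_iff_isPositive _).1 h2).inner_nonneg_right ψ
  let L : CompactlySupportedContinuousMap UnitAddCircle ℝ →ₚ[ℝ] ℝ := PositiveLinearMap.mk₀
    { toFun := fun f => (A (R f.toContinuousMap)).re
      map_add' := fun f f' => by
        rw [← Complex.add_re, ← map_add]
        congr 2
        ext x; simp [R]
      map_smul' := fun a f => by
        have : R (a • f).toContinuousMap = (a : ℂ) • R f.toContinuousMap := by
          ext x; simp [R]
        simp [this] }
    (fun f hf => (Complex.le_def.1 (hpos f.toContinuousMap (fun x => hf x))).1)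
  have hfin : IsFiniteMeasure (RealRMK.rieszMeasure L) := by infer_instance
  have hint : ∀ f : C(UnitAddCircle, ℝ),
      ((∫ x, f x ∂(RealRMK.rieszMeasure L) : ℝ) : ℂ) = A (R f) := by
    intro f
    have h1 : ∫ x, f x ∂(RealRMK.rieszMeasure L) = (A (R f)).re :=
      RealRMK.integral_rieszMeasure L (CompactlySupportedContinuousMap.continuousMapEquiv f)
    have h2 : star (Φ ((R f).comp g)) = Φ ((R f).comp g) := by
      rw [← map_star]
      congr 1
      ext z
      simp [R]
    have h3 : (starRingEnd ℂ) (A (R f)) = A (R f) := by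
      change (starRingEnd ℂ) ⟪ψ, Φ ((R f).comp g) ψ⟫_ℂ = ⟪ψ, Φ ((R f).comp g) ψ⟫_ℂ
      rw [inner_conj_symm, ← ContinuousLinearMap.adjoint_inner_right,
        ← ContinuousLinearMap.star_eq_adjoint, h2]
    rw [h1]
    exact Complex.conj_eq_iff_re.1 h3
  refine ⟨⟨RealRMK.rieszMeasure L, hfin⟩, fun n => ?_⟩
  have hΦ : Φ ((fourier (-n)).comp g) = ((u ^ n : unitary (H →L[ℂ] H)) : H →L[ℂ] H) := by
    have hid : Φ ((ContinuousMap.id ℂ).restrict (spectrum ℂ (u : H →L[ℂ] H))) = u := cfcHom_id hun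
    obtain ⟨m, rfl | rfl⟩ := n.eq_nat_or_neg
    · have h1 : (fourier (-(m : ℤ))).comp g =
          ((ContinuousMap.id ℂ).restrict (spectrum ℂ (u : H →L[ℂ] H))) ^ m := by
        ext z
        rw [ContinuousMap.comp_apply, hg]
        simp [c]
        rfl
      rw [h1, map_pow, hid, zpow_natCast]
      rfl
    · have h1 : (fourier (- -(m : ℤ))).comp g =
          star (((ContinuousMap.id ℂ).restrict (spectrum ℂ (u : H →L[ℂ] H))) ^ m) := by
        ext z
        rw [ContinuousMap.comp_apply, hg, zpow_neg, Circle.coe_inv_eq_conj]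
        simp [c]
        rfl
      rw [h1, map_star, map_pow, hid, zpow_neg, zpow_natCast]
      rfl
  have hU : (U ^ n) ψ = Φ ((fourier (-n)).comp g) ψ := by
    have h1 : Unitary.linearIsometryEquiv u = U := by simp [hu]
    rw [hΦ, ← h1, ← map_zpow]
    rfl
  let F : C(UnitAddCircle, ℂ) := fourier (-n)
  let f1 : C(UnitAddCircle, ℝ) := ⟨fun x => (F x).re, by fun_prop⟩
  let f2 : C(UnitAddCircle, ℝ) := ⟨fun x => (F x).im, by fun_prop⟩
  have hF : F = R f1 + Complex.I • R f2 := by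
    ext x
    change F x = ((F x).re : ℂ) + Complex.I * ((F x).im : ℂ)
    rw [mul_comm, Complex.re_add_im]
  have hI : Integrable (fun x => F x) (RealRMK.rieszMeasure L) :=
    F.continuous.integrable_of_hasCompactSupport (HasCompactSupport.of_compactSpace _)
  rw [hU]
  change ∫ x, F x ∂(RealRMK.rieszMeasure L) = A F
  have h4 := integral_re_add_im hI
  rw [← h4, hF, map_add, map_smul, ← hint, ← hint, smul_eq_mul, mul_comm Complex.I, ← hF]
  rfl

/-- The spectral measure `μ_ψ` of `ψ` for the unitary operator `U`. -/
def spectralMeasure (U : H ≃ₗᵢ[ℂ] H) (ψ : H) : FiniteMeasure UnitAddCircle :=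
  Classical.choose (exists_isSpectralMeasure U ψ)

theorem isSpectralMeasure_spectralMeasure (U : H ≃ₗᵢ[ℂ] H) (ψ : H) :
    IsSpectralMeasure U ψ (spectralMeasure U ψ) :=
  Classical.choose_spec (exists_isSpectralMeasure U ψ)

end SpectralMeasure

/-! ### Dynamical systems -/

section Dynamics

variable {Ω : Type*} [MeasurableSpace Ω]

/-- The unitary operator `U φ = φ ∘ T` on `L²(Ω, ν)`. -/
def koopman (T : Ω ≃ᵐ Ω) (ν : Measure Ω) (hT : MeasurePreserving T ν ν) :
    Lp ℂ 2 ν ≃ₗᵢ[ℂ] Lp ℂ 2 ν :=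
  LinearIsometryEquiv.ofSurjective (Lp.compMeasurePreservingₗᵢ ℂ T hT) (fun φ => by
    refine ⟨Lp.compMeasurePreserving T.symm (hT.symm T) φ, ?_⟩
    change Lp.compMeasurePreserving T hT (Lp.compMeasurePreserving T.symm (hT.symm T) φ) = φ
    apply Lp.ext
    have h1 := Lp.coeFn_compMeasurePreserving
      (Lp.compMeasurePreserving T.symm (hT.symm T) φ) hT
    have h2 := hT.quasiMeasurePreserving.ae_eq_comp
      (Lp.coeFn_compMeasurePreserving φ (hT.symm T))
    refine h1.trans (h2.trans (Eventually.of_forall fun x => ?_))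
    simp)

/-- The topological dynamical system `(Ω, T)` with invariant probability measure `ν` is uniquely
ergodic: `T` is continuous and `ν` is its only invariant Borel probability measure. -/
structure IsUniquelyErgodic [TopologicalSpace Ω] (T : Ω → Ω) (ν : Measure Ω) : Prop where
  continuous : Continuous T
  measurePreserving : MeasurePreserving T ν ν
  eq_of_invariant : ∀ ρ : Measure Ω, IsProbabilityMeasure ρ → MeasurePreserving T ρ ρ → ρ = ν

end Dynamics

/-! ### Twisted walks -/

section Walk

variable {Ω : Type*}

/-- The twisted walk `S_n^ω(λ) = ∑_{k<n} e^{2πiλk} ψ(T^k ω)`. -/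
def twistedSum (T : Ω → Ω) (ψ : Ω → ℂ) (ω : Ω) (n : ℕ) (l : UnitAddCircle) : ℂ :=
  ∑ k ∈ Finset.range n, fourier (k : ℤ) l * ψ (T^[k] ω)

theorem continuous_twistedSum (T : Ω → Ω) (ψ : Ω → ℂ) (ω : Ω) (n : ℕ) :
    Continuous (twistedSum T ψ ω n) := by
  unfold twistedSum
  exact continuous_finsetSum _ fun k _ => (fourier (k : ℤ)).continuous.mul continuous_const

/-- The finite measure `n⁻¹ |S_n^ω(λ)|² dλ` on the circle `ℝ/ℤ`, where `dλ` is Lebesgue measure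
(of total mass one). For `n = 0` it is the zero measure. -/
def periodogram (T : Ω → Ω) (ψ : Ω → ℂ) (ω : Ω) (n : ℕ) : FiniteMeasure UnitAddCircle :=
  ⟨(volume : Measure UnitAddCircle).withDensity
      (fun l => ENNReal.ofReal ((n : ℝ)⁻¹ * ‖twistedSum T ψ ω n l‖ ^ 2)), by
    have h : Continuous fun l => (n : ℝ)⁻¹ * ‖twistedSum T ψ ω n l‖ ^ 2 := by
      have := continuous_twistedSum T ψ ω n
      fun_prop
    exact isFiniteMeasure_withDensity_ofReal
      (h.integrable_of_hasCompactSupport (HasCompactSupport.of_compactSpace _)).2⟩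

end Walk

end TwistedWalk

end

/-! For `m ≥ 0`, orthogonality of characters leaves in the coefficient of `n⁻¹|S_n|² dλ` against
`e^{-2πimx}` only the pairs of times at distance `m`. It equals `n⁻¹` times the Birkhoff sum of
length `n - m` of the correlation `φ_m = (ψ ∘ T^m) · conj ψ` (`integral_fourier_periodogram`), while
the same coefficient of the spectral measure is `∫ φ_m dν`. So an ergodic theorem for every `φ_m` at
`ω` gives convergence of all coefficients, those of opposite sign following by conjugation. Density
of trigonometric polynomials and boundedness of the masses, which are the zeroth coefficients, turn
this into weak convergence (`tendsto_of_tendsto_integral_fourier`).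

Almost everywhere, the ergodic theorem is Birkhoff's for the integrable functions `φ_m`; it rests on
a maximal-function argument (`integral_nonneg_of_ae_not_bddAbove`). In the uniquely ergodic case
with `ψ` continuous it holds at every point: all cluster points of the empirical measures are
invariant, hence equal to `ν`, and the space of probability measures is compact. -/

noncomputable section

/-! ### The pointwise ergodic theorem -/

namespace ErgodicTheorem

variable {α : Type*}

/-- `birkhoffMax T f n x` is the maximum of the Birkhoff sums `birkhoffSum T f k x` over
`1 ≤ k ≤ n + 1`. -/
def birkhoffMax (T : α → α) (f : α → ℝ) : ℕ → α → ℝ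
  | 0 => f
  | n + 1 => fun x => f x + max 0 (birkhoffMax T f n (T x))

theorem birkhoffMax_succ (T : α → α) (f : α → ℝ) (n : ℕ) (x : α) :
    birkhoffMax T f (n + 1) x = f x + max 0 (birkhoffMax T f n (T x)) := rfl

theorem birkhoffMax_le_succ (T : α → α) (f : α → ℝ) (n : ℕ) (x : α) :
    birkhoffMax T f n x ≤ birkhoffMax T f (n + 1) x := by
  induction n generalizing x with
  | zero => exact le_add_of_nonneg_right (le_max_left _ _)
  | succ n ih =>
    rw [birkhoffMax_succ, birkhoffMax_succ T f (n + 1)]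
    gcongr
    exact ih _

theorem monotone_birkhoffMax (T : α → α) (f : α → ℝ) (x : α) :
    Monotone fun n => birkhoffMax T f n x :=
  monotone_nat_of_le_succ fun n => birkhoffMax_le_succ T f n x

theorem le_birkhoffMax (T : α → α) (f : α → ℝ) (n : ℕ) (x : α) : f x ≤ birkhoffMax T f n x :=
  monotone_birkhoffMax T f x (Nat.zero_le n)

theorem birkhoffSum_succ_le_birkhoffMax (T : α → α) (f : α → ℝ) (n : ℕ) (x : α) :
    birkhoffSum T f (n + 1) x ≤ birkhoffMax T f n x := by
  induction n generalizing x with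
  | zero => simp [birkhoffMax]
  | succ n ih =>
    rw [birkhoffSum_succ', birkhoffMax_succ]
    gcongr
    exact (ih _).trans (le_max_right _ _)

/-- By the recursion, a bound at either of `x`, `T x` yields one at the other. The boundedness set
is thus exactly invariant, ready for the zero-one law of ergodicity. -/
theorem bddAbove_birkhoffMax_comp_iff (T : α → α) (f : α → ℝ) (x : α) :
    BddAbove (Set.range fun n => birkhoffMax T f n (T x)) ↔
      BddAbove (Set.range fun n => birkhoffMax T f n x) := by
  constructor
  · rintro ⟨C, hC⟩
    refine ⟨f x + max 0 C, ?_⟩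
    rintro _ ⟨n, rfl⟩
    refine (birkhoffMax_le_succ T f n x).trans ?_
    rw [birkhoffMax_succ]
    gcongr
    exact hC ⟨n, rfl⟩
  · rintro ⟨C, hC⟩
    refine ⟨C - f x, ?_⟩
    rintro _ ⟨n, rfl⟩
    have h1 : birkhoffMax T f (n + 1) x ≤ C := hC ⟨n + 1, rfl⟩
    rw [birkhoffMax_succ] at h1
    have h2 := le_max_right 0 (birkhoffMax T f n (T x))
    dsimp only
    linarith

theorem birkhoffAverage_eq_re_add_im (T : α → α) (f : α → ℂ) (n : ℕ) (x : α) :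
    birkhoffAverage ℝ T f n x =
      Complex.ofReal (birkhoffAverage ℝ T (fun y => (f y).re) n x) +
        Complex.ofReal (birkhoffAverage ℝ T (fun y => (f y).im) n x) * Complex.I := by
  have hre := map_birkhoffAverage ℝ ℝ Complex.reCLM T f n x
  have him := map_birkhoffAverage ℝ ℝ Complex.imCLM T f n x
  rw [← Complex.re_add_im (birkhoffAverage ℝ T f n x)]
  exact congrArg₂ (fun a b : ℝ => (a : ℂ) + (b : ℂ) * Complex.I) hre him

variable [MeasurableSpace α] {μ : Measure α} {T : α → α} {f : α → ℝ}

theorem measurable_birkhoffMax (hT : Measurable T) (hf : Measurable f) (n : ℕ) :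
    Measurable (birkhoffMax T f n) := by
  induction n with
  | zero => exact hf
  | succ n ih => exact hf.add (measurable_const.max (ih.comp hT))

theorem integrable_birkhoffMax (hT : MeasurePreserving T μ μ) (hf : Integrable f μ) (n : ℕ) :
    Integrable (birkhoffMax T f n) μ := by
  induction n with
  | zero => exact hf
  | succ n ih =>
    exact hf.add ((integrable_zero α ℝ μ).sup (hT.integrable_comp_of_integrable ih))

theorem measurableSet_bddAbove_birkhoffMax (hT : Measurable T) (hf : Measurable f) :
    MeasurableSet {x | BddAbove (Set.range fun n => birkhoffMax T f n x)} :=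
  measurableSet_bddAbove_range fun n => measurable_birkhoffMax hT hf n

/-- If the Birkhoff sums of `f` are almost everywhere unbounded above, then `0 ≤ ∫ f`. -/
theorem integral_nonneg_of_ae_not_bddAbove (hT : MeasurePreserving T μ μ) (hf : Integrable f μ)
    (h : ∀ᵐ x ∂μ, ¬ BddAbove (Set.range fun n => birkhoffMax T f n x)) : 0 ≤ ∫ x, f x ∂μ := by
  -- With `M_n` for `birkhoffMax T f n`, the recursion gives `D n = f + (M_n ∘ T)⁻`. By invariance
  -- `∫ D n = ∫ (M_{n+1} - M_n) ≥ 0`. The negative part is at most `|f ∘ T|`, since `M_n ≥ f`, and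
  -- vanishes once `M_n ∘ T ≥ 0`; dominated convergence gives `∫ D n → ∫ f`.
  set D : ℕ → α → ℝ := fun n x => birkhoffMax T f (n + 1) x - birkhoffMax T f n (T x) with hD
  have hcomp : ∀ n, Integrable (fun x => birkhoffMax T f n (T x)) μ := fun n =>
    hT.integrable_comp_of_integrable (integrable_birkhoffMax hT hf n)
  have hDint : ∀ n, Integrable (D n) μ := fun n =>
    (integrable_birkhoffMax hT hf (n + 1)).sub (hcomp n)
  have hDnonneg : ∀ n, 0 ≤ ∫ x, D n x ∂μ := by
    intro n
    have h1 : ∫ x, birkhoffMax T f n (T x) ∂μ = ∫ x, birkhoffMax T f n x ∂μ := by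
      have h2 := integral_map (μ := μ) hT.measurable.aemeasurable
        (f := birkhoffMax T f n) (by
          rw [hT.map_eq]
          exact (integrable_birkhoffMax hT hf n).aestronglyMeasurable)
      rw [← h2, hT.map_eq]
    rw [hD, integral_sub (integrable_birkhoffMax hT hf (n + 1)) (hcomp n), h1, sub_nonneg]
    exact integral_mono (integrable_birkhoffMax hT hf n) (integrable_birkhoffMax hT hf (n + 1))
      (birkhoffMax_le_succ T f n)
  have hDbound : ∀ n, ∀ᵐ x ∂μ, ‖D n x‖ ≤ |f x| + |f (T x)| := by
    refine fun n => Eventually.of_forall fun x => ?_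
    have h1 := le_birkhoffMax T f n (T x)
    have h2 := neg_abs_le (f (T x))
    have h3 := neg_abs_le (f x)
    have h4 := le_abs_self (f x)
    have h5 := abs_nonneg (f (T x))
    simp only [hD, birkhoffMax_succ, Real.norm_eq_abs]
    rw [abs_le]
    rcases max_cases 0 (birkhoffMax T f n (T x)) with h | h <;> constructor <;> linarith
  have hlim : ∀ᵐ x ∂μ, Tendsto (fun n => D n x) atTop (𝓝 (f x)) := by
    filter_upwards [h] with x hx
    rw [← bddAbove_birkhoffMax_comp_iff] at hx
    have h1 : Tendsto (fun n => birkhoffMax T f n (T x)) atTop atTop :=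
      tendsto_atTop_atTop_of_monotone (monotone_birkhoffMax T f (T x)) fun b => by
        by_contra! hb
        exact hx ⟨b, by rintro _ ⟨n, rfl⟩; exact (hb n).le⟩
    refine tendsto_const_nhds.congr' ?_
    filter_upwards [h1.eventually_ge_atTop 0] with n hn
    simp [hD, birkhoffMax_succ, max_eq_right hn]
  exact ge_of_tendsto' (tendsto_integral_of_dominated_convergence (fun x => |f x| + |f (T x)|)
    (fun n => (hDint n).aestronglyMeasurable)
    (hf.abs.add (hT.integrable_comp_of_integrable hf).abs) hDbound hlim) hDnonneg

/-- By ergodicity the invariant boundedness set is null or conull, and null would force `0 ≤ ∫ f`.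
-/
theorem ae_bddAbove_birkhoffMax (hT : Ergodic T μ) (hfm : Measurable f) (hf : Integrable f μ)
    (hneg : ∫ x, f x ∂μ < 0) :
    ∀ᵐ x ∂μ, BddAbove (Set.range fun n => birkhoffMax T f n x) := by
  rcases hT.toPreErgodic.ae_mem_or_ae_notMem
    (measurableSet_bddAbove_birkhoffMax hT.measurable hfm)
    (Set.ext fun x => bddAbove_birkhoffMax_comp_iff T f x) with h | h
  · exact h
  · exact absurd (integral_nonneg_of_ae_not_bddAbove hT.toMeasurePreserving hf h) hneg.not_ge

theorem ae_eventually_birkhoffAverage_le [IsProbabilityMeasure μ] (hT : Ergodic T μ)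
    (hfm : Measurable f) (hf : Integrable f μ) {c : ℝ} (hc : ∫ x, f x ∂μ < c) :
    ∀ᵐ x ∂μ, ∀ᶠ n : ℕ in atTop, birkhoffAverage ℝ T f n x < c := by
  -- The sums of `f - b` are bounded by some `C`, and the gap `c - b` absorbs `C / n`.
  obtain ⟨b, hb, hbc⟩ := exists_between hc
  have hneg : ∫ x, (f x - b) ∂μ < 0 := by
    rw [integral_sub hf (integrable_const b)]
    simpa using hb
  filter_upwards [ae_bddAbove_birkhoffMax hT (hfm.sub_const b) (hf.sub (integrable_const b)) hneg]
    with x hx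
  obtain ⟨C, hC⟩ := hx
  have h1 : ∀ᶠ n : ℕ in atTop, C / n < c - b :=
    (tendsto_const_div_atTop_nhds_zero_nat C).eventually_lt_const (sub_pos.2 hbc)
  filter_upwards [h1, eventually_gt_atTop 0] with n hn hn0
  obtain ⟨m, rfl⟩ := Nat.exists_eq_succ_of_ne_zero hn0.ne'
  have h2 : birkhoffSum T (fun x => f x - b) (m + 1) x ≤ C :=
    (birkhoffSum_succ_le_birkhoffMax T _ m x).trans (hC ⟨m, rfl⟩)
  have h3 : birkhoffSum T (fun x => f x - b) (m + 1) x =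
      birkhoffSum T f (m + 1) x - (m + 1 : ℕ) * b := by
    simp [birkhoffSum, Finset.sum_sub_distrib]
  have hpos : (0 : ℝ) < (m + 1 : ℕ) := by positivity
  rw [div_lt_iff₀ hpos] at hn
  rw [birkhoffAverage, smul_eq_mul, inv_mul_lt_iff₀ hpos]
  linarith

theorem tendsto_birkhoffAverage_of_measurable [IsProbabilityMeasure μ] (hT : Ergodic T μ)
    (hfm : Measurable f) (hf : Integrable f μ) :
    ∀ᵐ x ∂μ, Tendsto (fun n => birkhoffAverage ℝ T f n x) atTop (𝓝 (∫ x, f x ∂μ)) := by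
  have h1 : ∀ᵐ x ∂μ, ∀ j : ℕ, ∀ᶠ n : ℕ in atTop,
      birkhoffAverage ℝ T f n x < ∫ x, f x ∂μ + 1 / ((j : ℝ) + 1) :=
    ae_all_iff.2 fun j => ae_eventually_birkhoffAverage_le hT hfm hf
      (lt_add_of_pos_right _ Nat.one_div_pos_of_nat)
  have h2 : ∀ᵐ x ∂μ, ∀ j : ℕ, ∀ᶠ n : ℕ in atTop,
      birkhoffAverage ℝ T (-f) n x < -∫ x, f x ∂μ + 1 / ((j : ℝ) + 1) :=
    ae_all_iff.2 fun j => ae_eventually_birkhoffAverage_le hT hfm.neg hf.neg (by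
      rw [← integral_neg]
      exact lt_add_of_pos_right _ Nat.one_div_pos_of_nat)
  filter_upwards [h1, h2] with x hx1 hx2
  rw [Metric.tendsto_nhds]
  intro ε hε
  obtain ⟨j, hj⟩ := exists_nat_one_div_lt hε
  filter_upwards [hx1 j, hx2 j] with n hn1 hn2
  rw [birkhoffAverage_neg] at hn2
  simp only [Pi.neg_apply] at hn2
  rw [Real.dist_eq, abs_lt]
  constructor <;> linarith

/-- **Birkhoff's pointwise ergodic theorem** for real functions and ergodic transformations. -/
theorem tendsto_birkhoffAverage_real [IsProbabilityMeasure μ] (hT : Ergodic T μ)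
    (hf : Integrable f μ) :
    ∀ᵐ x ∂μ, Tendsto (fun n => birkhoffAverage ℝ T f n x) atTop (𝓝 (∫ x, f x ∂μ)) := by
  -- The zero-one law above needs a genuinely measurable set, hence a measurable representative.
  set g := hf.aemeasurable.mk f
  have hfg : f =ᵐ[μ] g := hf.aemeasurable.ae_eq_mk
  have h1 : ∀ᵐ x ∂μ, ∀ n, birkhoffAverage ℝ T f n x = birkhoffAverage ℝ T g n x :=
    ae_all_iff.2 fun n => hT.quasiMeasurePreserving.birkhoffAverage_ae_eq_of_ae_eq ℝ hfg n
  filter_upwards [h1, tendsto_birkhoffAverage_of_measurable hT hf.aemeasurable.measurable_mk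
    (hf.congr hfg)] with x hx1 hx2
  simp only [hx1]
  rwa [integral_congr_ae hfg]

theorem tendsto_birkhoffAverage_of_re_im {f : α → ℂ} (hf : Integrable f μ) {x : α}
    (hre : Tendsto (fun n => birkhoffAverage ℝ T (fun y => (f y).re) n x) atTop
      (𝓝 (∫ y, (f y).re ∂μ)))
    (him : Tendsto (fun n => birkhoffAverage ℝ T (fun y => (f y).im) n x) atTop
      (𝓝 (∫ y, (f y).im ∂μ))) :
    Tendsto (fun n => birkhoffAverage ℝ T f n x) atTop (𝓝 (∫ y, f y ∂μ)) := by
  have h1 := integral_re_add_im hf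
  simp only [birkhoffAverage_eq_re_add_im T f]
  rw [← h1]
  exact ((Complex.continuous_ofReal.tendsto _).comp hre).add
    (((Complex.continuous_ofReal.tendsto _).comp him).mul_const _)

/-- **Birkhoff's pointwise ergodic theorem** for complex functions and ergodic transformations. -/
theorem tendsto_birkhoffAverage [IsProbabilityMeasure μ] (hT : Ergodic T μ) {f : α → ℂ}
    (hf : Integrable f μ) :
    ∀ᵐ x ∂μ, Tendsto (fun n => birkhoffAverage ℝ T f n x) atTop (𝓝 (∫ x, f x ∂μ)) := by
  filter_upwards [tendsto_birkhoffAverage_real hT hf.re, tendsto_birkhoffAverage_real hT hf.im]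
    with x hre him
  exact tendsto_birkhoffAverage_of_re_im hf hre him

end ErgodicTheorem

/-! ### Uniquely ergodic systems -/

namespace UniquelyErgodic

variable {α : Type*} [MeasurableSpace α]

/-- The empirical measure of the first `n + 1` points of the orbit of `x`. -/
def empiricalMeasure (T : α → α) (x : α) (n : ℕ) : ProbabilityMeasure α :=
  ⟨((n + 1 : ℕ) : ℝ≥0∞)⁻¹ • ∑ k ∈ Finset.range (n + 1), Measure.dirac (T^[k] x), ⟨by
    rw [Measure.smul_apply, Measure.finsetSum_apply]
    simp only [measure_univ, Finset.sum_const, Finset.card_range, nsmul_eq_mul, mul_one,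
      smul_eq_mul]
    exact ENNReal.inv_mul_cancel (by simp) (ENNReal.natCast_ne_top _)⟩⟩

variable [TopologicalSpace α]

theorem integral_empiricalMeasure [OpensMeasurableSpace α] (T : α → α) (x : α) (n : ℕ)
    {f : α → ℝ} (hf : Continuous f) :
    ∫ y, f y ∂(empiricalMeasure T x n : Measure α) = birkhoffAverage ℝ T f (n + 1) x := by
  change ∫ y, f y ∂(((n + 1 : ℕ) : ℝ≥0∞)⁻¹ •
    ∑ k ∈ Finset.range (n + 1), Measure.dirac (T^[k] x)) = _
  have hint : ∀ y, Integrable f (Measure.dirac y) := fun y =>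
    integrable_dirac' hf.measurable.stronglyMeasurable (by simp)
  rw [integral_smul_measure, integral_finsetSum_measure fun k _ => hint _]
  simp only [integral_dirac' _ _ hf.measurable.stronglyMeasurable]
  rw [ENNReal.toReal_inv, ENNReal.toReal_natCast, birkhoffAverage, birkhoffSum]

variable [CompactSpace α] [HasOuterApproxClosed α] [BorelSpace α] {T : α → α}

/-- The Krylov–Bogolyubov argument: averages of a bounded function along the orbits of `x` and `T x`
differ by `O(1/n)`, so a limit cannot distinguish `f` from `f ∘ T`. -/
theorem measurePreserving_of_mapClusterPt (hT : Continuous T) (x : α) {ρ : ProbabilityMeasure α}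
    (hρ : MapClusterPt ρ atTop (empiricalMeasure T x)) :
    MeasurePreserving T (ρ : Measure α) (ρ : Measure α) := by
  refine ⟨hT.measurable, ?_⟩
  have hprob : IsProbabilityMeasure (Measure.map T (ρ : Measure α)) :=
    Measure.isProbabilityMeasure_map hT.measurable.aemeasurable
  apply ext_of_forall_integral_eq_of_IsFiniteMeasure
  intro f
  rw [integral_map hT.measurable.aemeasurable f.continuous.aestronglyMeasurable_of_compactSpace]
  -- Along an ultrafilter the cluster point becomes a limit.
  obtain ⟨U, hU, hUρ⟩ := mapClusterPt_iff_ultrafilter.1 hρ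
  rw [ProbabilityMeasure.tendsto_iff_forall_integral_tendsto] at hUρ
  have h1 := hUρ f
  have h2 := hUρ (f.compContinuous ⟨T, hT⟩)
  simp only [BoundedContinuousFunction.compContinuous_apply, ContinuousMap.coe_mk] at h2
  have h3 : Tendsto (fun n => birkhoffAverage ℝ T f (n + 1) (T x) -
      birkhoffAverage ℝ T f (n + 1) x) (U : Filter ℕ) (𝓝 0) :=
    ((tendsto_birkhoffAverage_apply_sub_birkhoffAverage' (𝕜 := ℝ) f.isBounded_range T x).comp
      (tendsto_add_atTop_nat 1)).mono_left hU
  refine tendsto_nhds_unique (h2.sub h1 |>.congr fun n => ?_) h3 |> sub_eq_zero.1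
  rw [integral_empiricalMeasure T x n f.continuous,
    integral_empiricalMeasure T x n (f := fun y => f (T y)) (f.continuous.comp hT)]
  congr 1
  simp [birkhoffAverage, birkhoffSum, ← Function.iterate_succ_apply', Function.iterate_succ_apply]

variable [T2Space α] {ν : Measure α} [IsProbabilityMeasure ν]

theorem tendsto_empiricalMeasure (hT : TwistedWalk.IsUniquelyErgodic T ν) (x : α) :
    Tendsto (empiricalMeasure T x) atTop (𝓝 ⟨ν, inferInstance⟩) :=
  le_nhds_of_unique_clusterPt fun ρ hρ => Subtype.ext <|
    hT.eq_of_invariant ρ inferInstance (measurePreserving_of_mapClusterPt hT.continuous x hρ)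

theorem tendsto_birkhoffAverage_real (hT : TwistedWalk.IsUniquelyErgodic T ν) {f : α → ℝ}
    (hf : Continuous f) (x : α) :
    Tendsto (fun n => birkhoffAverage ℝ T f n x) atTop (𝓝 (∫ y, f y ∂ν)) := by
  have h1 := ProbabilityMeasure.tendsto_iff_forall_integral_tendsto.1
    (tendsto_empiricalMeasure hT x) (BoundedContinuousFunction.mkOfCompact ⟨f, hf⟩)
  simp only [BoundedContinuousFunction.mkOfCompact_apply, ContinuousMap.coe_mk,
    integral_empiricalMeasure T x _ hf] at h1
  exact (tendsto_add_atTop_iff_nat 1).1 h1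

/-- In a uniquely ergodic system the Birkhoff averages of a continuous function converge
everywhere. -/
theorem tendsto_birkhoffAverage (hT : TwistedWalk.IsUniquelyErgodic T ν) {f : α → ℂ}
    (hf : Continuous f) (x : α) :
    Tendsto (fun n => birkhoffAverage ℝ T f n x) atTop (𝓝 (∫ y, f y ∂ν)) :=
  ErgodicTheorem.tendsto_birkhoffAverage_of_re_im
    (hf.integrable_of_hasCompactSupport (HasCompactSupport.of_compactSpace _))
    (tendsto_birkhoffAverage_real hT (Complex.continuous_re.comp hf) x)
    (tendsto_birkhoffAverage_real hT (Complex.continuous_im.comp hf) x)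

end UniquelyErgodic

/-! ### Weak convergence on the circle -/

namespace TwistedWalk

theorem integral_fourier (n : ℤ) :
    ∫ x : UnitAddCircle, fourier n x = if n = 0 then 1 else 0 := by
  split_ifs with h
  · subst h
    simp [Measure.real]
  -- Translation by half a period of the character changes its sign.
  · exact integral_eq_zero_of_add_right_eq_neg (fourier_add_half_inv_index h one_pos)

theorem integrable_of_continuous {μ : Measure UnitAddCircle} [IsFiniteMeasure μ]
    {f : UnitAddCircle → ℂ} (hf : Continuous f) : Integrable f μ :=
  hf.integrable_of_hasCompactSupport (HasCompactSupport.of_compactSpace _)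

theorem integral_fourier_neg (μ : Measure UnitAddCircle) (n : ℤ) :
    ∫ x, fourier (-n) x ∂μ = (starRingEnd ℂ) (∫ x, fourier n x ∂μ) := by
  rw [← integral_conj]
  simp only [fourier_neg]

theorem norm_integralFunctional_le (μ : FiniteMeasure UnitAddCircle) :
    ‖integralFunctional μ‖ ≤ ‖∫ x, fourier 0 x ∂(μ : Measure UnitAddCircle)‖ := by
  refine (LinearMap.mkContinuous_norm_le _ measureReal_nonneg _).trans ?_
  simp

/-- Weak convergence of finite measures on the circle follows from the convergence of their
Fourier coefficients. -/
theorem tendsto_of_tendsto_integral_fourier {μs : ℕ → FiniteMeasure UnitAddCircle}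
    {μ : FiniteMeasure UnitAddCircle}
    (h : ∀ n : ℤ, Tendsto (fun i => ∫ x, fourier n x ∂(μs i : Measure UnitAddCircle)) atTop
      (𝓝 (∫ x, fourier n x ∂(μ : Measure UnitAddCircle)))) :
    Tendsto μs atTop (𝓝 μ) := by
  -- The zeroth coefficient is the total mass, so the functionals are uniformly bounded, hence
  -- equicontinuous; the set of functions on which they converge is then closed.
  obtain ⟨C, hC⟩ := (h 0).norm.bddAbove_range
  have hnorm : ∀ i, ‖integralFunctional (μs i)‖ ≤ C := fun i =>
    (norm_integralFunctional_le _).trans (hC ⟨i, rfl⟩)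
  have hequi : Equicontinuous fun i => ⇑(integralFunctional (μs i)) :=
    (LipschitzWith.uniformEquicontinuous _ C.toNNReal fun i =>
      (integralFunctional (μs i)).lipschitz.weaken
        (NNReal.le_toNNReal_of_coe_le (hnorm i))).equicontinuous
  have hclosed := hequi.isClosed_setOfPred_tendsto (l := atTop) (integralFunctional μ).continuous
  have hspan : ∀ f ∈ Submodule.span ℂ (Set.range (@fourier 1)),
      Tendsto (fun i => integralFunctional (μs i) f) atTop (𝓝 (integralFunctional μ f)) := by
    intro f hf
    induction hf using Submodule.span_induction with
    | mem f hf =>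
      obtain ⟨n, rfl⟩ := hf
      exact h n
    | zero => simp
    | add f g _ _ hf hg => simpa using hf.add hg
    | smul c f _ hf => simpa using hf.const_mul c
  have hdense : Dense (Submodule.span ℂ (Set.range (@fourier 1)) : Set C(UnitAddCircle, ℂ)) :=
    Submodule.dense_iff_topologicalClosure_eq_top.2 span_fourier_closure_eq_top
  have hall : ∀ f, Tendsto (fun i => integralFunctional (μs i) f) atTop
      (𝓝 (integralFunctional μ f)) := fun f =>
    hclosed.closure_subset_iff.2 hspan (hdense f)
  exact (FiniteMeasure.tendsto_iff_forall_integral_rclike_tendsto ℂ).2 fun f =>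
    hall f.toContinuousMap

/-! ### Fourier coefficients of the periodogram -/

variable {Ω : Type*}

theorem integral_periodogram (T : Ω → Ω) (ψ : Ω → ℂ) (ω : Ω) (n : ℕ) (g : UnitAddCircle → ℂ) :
    ∫ x, g x ∂(periodogram T ψ ω n : Measure UnitAddCircle) =
      (n : ℂ)⁻¹ * ∫ x, twistedSum T ψ ω n x * (starRingEnd ℂ) (twistedSum T ψ ω n x) * g x := by
  have hcont := continuous_twistedSum T ψ ω n
  have hmeas : Measurable fun x => ENNReal.ofReal ((n : ℝ)⁻¹ * ‖twistedSum T ψ ω n x‖ ^ 2) := by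
    apply Measurable.ennreal_ofReal
    exact (by fun_prop : Continuous _).measurable
  change ∫ x, g x ∂(volume.withDensity _) = _
  rw [integral_withDensity_eq_integral_toReal_smul hmeas
    (Eventually.of_forall fun _ => ENNReal.ofReal_lt_top), ← integral_const_mul]
  congr 1
  ext x
  rw [ENNReal.toReal_ofReal (by positivity), Complex.mul_conj, Complex.normSq_eq_norm_sq,
    Complex.real_smul]
  push_cast
  ring

theorem twistedSum_mul_conj_mul_fourier (T : Ω → Ω) (ψ : Ω → ℂ) (ω : Ω) (n : ℕ) (m : ℤ)
    (x : UnitAddCircle) :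
    twistedSum T ψ ω n x * (starRingEnd ℂ) (twistedSum T ψ ω n x) * fourier (-m) x =
      ∑ l ∈ Finset.range n, ∑ k ∈ Finset.range n,
        ψ (T^[k] ω) * (starRingEnd ℂ) (ψ (T^[l] ω)) * fourier ((k : ℤ) - l - m) x := by
  simp only [twistedSum, map_sum, map_mul, ← fourier_neg]
  rw [Finset.sum_mul_sum, Finset.sum_comm, Finset.sum_mul]
  refine Finset.sum_congr rfl fun l _ => ?_
  rw [Finset.sum_mul]
  refine Finset.sum_congr rfl fun k _ => ?_
  rw [sub_eq_add_neg, sub_eq_add_neg, fourier_add, fourier_add]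
  ring

/-- The Fourier coefficients of the periodogram are the empirical correlations of the walk. -/
theorem integral_fourier_periodogram (T : Ω → Ω) (ψ : Ω → ℂ) (ω : Ω) (n m : ℕ) :
    ∫ x, fourier (-(m : ℤ)) x ∂(periodogram T ψ ω n : Measure UnitAddCircle) =
      (n : ℂ)⁻¹ * birkhoffSum T (fun y => ψ (T^[m] y) * (starRingEnd ℂ) (ψ y)) (n - m) ω := by
  rw [integral_periodogram]
  congr 1
  simp only [twistedSum_mul_conj_mul_fourier]
  have hint : ∀ k l : ℕ, Integrable (fun x : UnitAddCircle =>
      ψ (T^[k] ω) * (starRingEnd ℂ) (ψ (T^[l] ω)) * fourier ((k : ℤ) - l - m) x) := fun k l =>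
    integrable_of_continuous (by fun_prop)
  rw [integral_finsetSum _ fun l _ => integrable_finsetSum _ fun k _ => hint k l]
  have hterm : ∀ l ∈ Finset.range n, ∫ x : UnitAddCircle, ∑ k ∈ Finset.range n,
      ψ (T^[k] ω) * (starRingEnd ℂ) (ψ (T^[l] ω)) * fourier ((k : ℤ) - l - m) x =
      if l ∈ Finset.range (n - m) then ψ (T^[m] (T^[l] ω)) * (starRingEnd ℂ) (ψ (T^[l] ω))
        else 0 := by
    intro l _
    rw [integral_finsetSum _ fun k _ => hint k l]
    have h1 : ∀ k ∈ Finset.range n, ∫ x : UnitAddCircle,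
        ψ (T^[k] ω) * (starRingEnd ℂ) (ψ (T^[l] ω)) * fourier ((k : ℤ) - l - m) x =
        if m + l = k then ψ (T^[k] ω) * (starRingEnd ℂ) (ψ (T^[l] ω)) else 0 := by
      intro k _
      rw [integral_const_mul, integral_fourier, mul_ite, mul_one, mul_zero]
      congr 1
      exact propext (by omega)
    -- Only `k = m + l` survives, and it lies in the range exactly when `l < n - m`, also under
    -- truncated subtraction.
    rw [Finset.sum_congr rfl h1, Finset.sum_ite_eq, Function.iterate_add_apply]
    congr 1
    simp only [Finset.mem_range]
    exact propext (by omega)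
  rw [Finset.sum_congr rfl hterm, Finset.sum_ite_mem,
    Finset.inter_eq_right.2 (Finset.range_subset_range.2 (Nat.sub_le n m))]
  rfl

theorem tendsto_integral_fourier_periodogram {T : Ω → Ω} {ψ : Ω → ℂ} {ω : Ω} {m : ℕ} {c : ℂ}
    (h : Tendsto (fun n => birkhoffAverage ℝ T
      (fun y => ψ (T^[m] y) * (starRingEnd ℂ) (ψ y)) n ω) atTop (𝓝 c)) :
    Tendsto (fun n => ∫ x, fourier (-(m : ℤ)) x ∂(periodogram T ψ ω n : Measure UnitAddCircle))
      atTop (𝓝 c) := by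
  -- Shifting `n` by `m` removes the truncated subtraction; the normalisation then costs a factor `n
  -- / (n + m) → 1`.
  rw [← tendsto_add_atTop_iff_nat m]
  have h1 : Tendsto (fun n : ℕ => (n : ℂ) / (n + m : ℂ)) atTop (𝓝 1) :=
    tendsto_natCast_div_add_atTop (m : ℂ)
  have h2 := h1.mul h
  rw [one_mul] at h2
  refine h2.congr' ?_
  filter_upwards [eventually_gt_atTop 0] with n hn
  have hn' : (n : ℂ) ≠ 0 := by exact_mod_cast hn.ne'
  rw [integral_fourier_periodogram, Nat.add_sub_cancel, birkhoffAverage, Complex.real_smul]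
  push_cast
  field_simp

/-! ### Correlations -/

variable [MeasurableSpace Ω]

theorem koopman_pow_coeFn (T : Ω ≃ᵐ Ω) (ν : Measure Ω) (hT : MeasurePreserving T ν ν)
    {ψ : Ω → ℂ} (hψ : MemLp ψ 2 ν) (m : ℕ) :
    ((koopman T ν hT ^ m) (hψ.toLp ψ) : Ω → ℂ) =ᵐ[ν] fun x => ψ (T^[m] x) := by
  induction m with
  | zero => exact hψ.coeFn_toLp
  | succ m ih =>
    rw [pow_succ']
    refine (Lp.coeFn_compMeasurePreserving _ hT).trans
      ((hT.quasiMeasurePreserving.ae_eq_comp ih).trans (Eventually.of_forall fun x => ?_))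
    simp

theorem integral_fourier_spectralMeasure (T : Ω ≃ᵐ Ω) (ν : Measure Ω)
    (hT : MeasurePreserving T ν ν) {ψ : Ω → ℂ} (hψ : MemLp ψ 2 ν) (m : ℕ) :
    ∫ x, fourier (-(m : ℤ)) x
        ∂(spectralMeasure (koopman T ν hT) (hψ.toLp ψ) : Measure UnitAddCircle) =
      ∫ y, ψ (T^[m] y) * (starRingEnd ℂ) (ψ y) ∂ν := by
  rw [isSpectralMeasure_spectralMeasure, zpow_natCast, L2.inner_def]
  refine integral_congr_ae ?_
  filter_upwards [koopman_pow_coeFn T ν hT hψ m, hψ.coeFn_toLp] with x hx1 hx2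
  rw [hx1, hx2]
  rfl

theorem integrable_correlation {T : Ω → Ω} {ν : Measure Ω}
    (hT : MeasurePreserving T ν ν) {ψ : Ω → ℂ} (hψ : MemLp ψ 2 ν) (m : ℕ) :
    Integrable (fun y => ψ (T^[m] y) * (starRingEnd ℂ) (ψ y)) ν :=
  (hψ.comp_measurePreserving (hT.iterate m)).integrable_mul hψ.star

/-- The periodograms converge weakly to the spectral measure at each point at which the Birkhoff
averages of all correlations converge. -/
theorem tendsto_periodogram {T : Ω ≃ᵐ Ω} {ν : Measure Ω} (hT : MeasurePreserving T ν ν)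
    {ψ : Ω → ℂ} (hψ : MemLp ψ 2 ν) {ω : Ω}
    (h : ∀ m : ℕ, Tendsto (fun n => birkhoffAverage ℝ T
      (fun y => ψ (T^[m] y) * (starRingEnd ℂ) (ψ y)) n ω) atTop
        (𝓝 (∫ y, ψ (T^[m] y) * (starRingEnd ℂ) (ψ y) ∂ν))) :
    Tendsto (fun n : ℕ => periodogram T ψ ω n) atTop
      (𝓝 (spectralMeasure (koopman T ν hT) (hψ.toLp ψ))) := by
  have key : ∀ m : ℕ, Tendsto
      (fun n => ∫ x, fourier (-(m : ℤ)) x ∂(periodogram T ψ ω n : Measure UnitAddCircle)) atTop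
      (𝓝 (∫ x, fourier (-(m : ℤ)) x
        ∂(spectralMeasure (koopman T ν hT) (hψ.toLp ψ) : Measure UnitAddCircle))) := by
    intro m
    rw [integral_fourier_spectralMeasure]
    exact tendsto_integral_fourier_periodogram (h m)
  refine tendsto_of_tendsto_integral_fourier fun m => ?_
  obtain ⟨m, rfl | rfl⟩ := m.eq_nat_or_neg
  · rw [← neg_neg (m : ℤ)]
    -- The measures are positive, so opposite coefficients are conjugate.
    simp only [integral_fourier_neg _ (-(m : ℤ))]
    exact (Complex.continuous_conj.tendsto _).comp (key m)
  · exact key m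

end TwistedWalk

end

theorem lemma4p4 {Ω : Type*} [MetricSpace Ω] [CompactSpace Ω] [MeasurableSpace Ω] [BorelSpace Ω]
    (T : Ω ≃ᵐ Ω) (ν : Measure Ω) [IsProbabilityMeasure ν] (hT : Ergodic T ν)
    (ψ : Ω → ℂ) (hψ : MemLp ψ 2 ν) :
    (∀ᵐ ω ∂ν, Tendsto (fun n : ℕ => TwistedWalk.periodogram T ψ ω n) atTop
      (𝓝 (TwistedWalk.spectralMeasure
        (TwistedWalk.koopman T ν hT.toMeasurePreserving) (hψ.toLp ψ)))) ∧
    (TwistedWalk.IsUniquelyErgodic T ν → Continuous ψ →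
      ∀ ω : Ω, Tendsto (fun n : ℕ => TwistedWalk.periodogram T ψ ω n) atTop
        (𝓝 (TwistedWalk.spectralMeasure
          (TwistedWalk.koopman T ν hT.toMeasurePreserving) (hψ.toLp ψ)))) := by
  constructor
  -- Countably many correlations, hence one common set of full measure.
  · have h : ∀ᵐ ω ∂ν, ∀ m : ℕ, Tendsto (fun n => birkhoffAverage ℝ T
        (fun y => ψ (T^[m] y) * (starRingEnd ℂ) (ψ y)) n ω) atTop
          (𝓝 (∫ y, ψ (T^[m] y) * (starRingEnd ℂ) (ψ y) ∂ν)) :=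
      ae_all_iff.2 fun m => ErgodicTheorem.tendsto_birkhoffAverage hT
        (TwistedWalk.integrable_correlation hT.toMeasurePreserving hψ m)
    filter_upwards [h] with ω hω
    exact TwistedWalk.tendsto_periodogram hT.toMeasurePreserving hψ hω
  · intro hue hcont ω
    exact TwistedWalk.tendsto_periodogram hT.toMeasurePreserving hψ fun m =>
      UniquelyErgodic.tendsto_birkhoffAverage hue
        ((hcont.comp (hue.continuous.iterate m)).mul (Complex.continuous_conj.comp hcont)) ω
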